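/- Let $m$ be a positive integer with $2m\not\equiv 1 \pmod 3$, let $n=3m$, and regard $\mathbb{F}_{2^m}$ as a subfield of $\mathbb{F}_{2^n}$. For $\delta\in\mathbb{F}_{2^n}$ let $F\colon\mathbb{F}_{2^n}\to\mathbb{F}_{2^n}$ be the function $$F(X)=(X^{2^m}+X+\delta)^{2^{3m-1}+2^{m-1}}+X .$$ For $a,b,c\in\mathbb{F}_{2^n}$ let ${}_c\Delta_F(a,b)$ be the number of $X\in\mathbb{F}_{2^n}$ with $F(X+a)-cF(X)=b$, and let the $c$-differential uniformity of $F$ be $${}_c\Delta_F=\max\{{}_c\Delta_F(a,b) : a,b\in\mathbb{F}_{2^n},\ a\neq 0 \text{ if } c=1\}.$$ The function $F$ is called P$c$N if ${}_c\Delta_F=1$, and AP$c$N if ${}_c\Delta_F=2$. Let ${\rm Tr}_m^{3m}(x)=x+x^{2^m}+x^{2^{2m}}$ and $\Gamma_0=\{\delta\in\mathbb{F}_{2^n} : {\rm Tr}_m^{3m}(\delta)=0\}$. Then: 1. $F$ is P$c$N for all $c\in\mathbb{F}_{2^m}\setminus\{1\}$ and all $\delta\in\mathbb{F}_{2^n}$;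 2. $F$ is AP$c$N for all $c\in\mathbb{F}_{2^n}\setminus\mathbb{F}_{2^m}$ and all $\delta\in\Gamma_0$; 3. ${}_c\Delta_F\le 4$ for all $c\in\mathbb{F}_{2^n}\setminus\mathbb{F}_{2^m}$ and all $\delta\in\mathbb{F}_{2^n}\setminus\Gamma_0$. -/

import Mathlib

/-- The relative trace `x ↦ ∑_{i=0}^{(n-m)/m} x^(p^(m i))` from the field with `p^n` elements to its
subfield with `p^m` elements, for `m ≥ 1` and `m ∣ n`; there are `n / m` summands. -/
def relTrace {K : Type*} [Field K] (p m n : ℕ) (x : K) : K :=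
  ∑ i ∈ Finset.range (n / m), x ^ (p ^ (m * i))

/-- The `c`-derivative `X ↦ F (X + a) - c F(X)` of `F` in the direction `a`. -/
def cDerivative {K : Type*} [Field K] (F : K → K) (c a X : K) : K :=
  F (X + a) - c * F X

/-- The entry of the `c`-difference distribution table of `F` at `(a, b)`: the number of solutions
`X` of `F (X + a) - c F(X) = b`. -/
noncomputable def cDDT {K : Type*} [Field K] (F : K → K) (c a b : K) : ℕ :=
  Set.ncard {X : K | cDerivative F c a X = b}

open Classical in
/-- The `c`-differential uniformity of `F`: the maximum of the entries at `(a, b)` over all `a` and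
`b`, where `a = 0` is left out if `c = 1`. -/
noncomputable def cDiffUniformity {K : Type*} [Field K] [Fintype K] (F : K → K) (c : K) : ℕ :=
  (Finset.univ.filter fun ab : K × K => c = 1 → ab.1 ≠ 0).sup fun ab => cDDT F c ab.1 ab.2

/-- Perfect `c`-nonlinear functions. -/
def IsPcN {K : Type*} [Field K] [Fintype K] (F : K → K) (c : K) : Prop :=
  cDiffUniformity F c = 1

/-- Almost perfect `c`-nonlinear functions. -/
def IsAPcN {K : Type*} [Field K] [Fintype K] (F : K → K) (c : K) : Prop :=
  cDiffUniformity F c = 2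

/-- The function `F(X) = (X^(2^m) + X + δ)^(2^(3m-1) + 2^(m-1)) + X`, for `m ≥ 1`. -/
def permF {K : Type*} [Field K] (m : ℕ) (δ : K) (X : K) : K :=
  (X ^ (2 ^ m) + X + δ) ^ (2 ^ (3 * m - 1) + 2 ^ (m - 1)) + X

/-! Let σ be x ↦ x^(2^m), so σ³ = 1, and put Y = σX + X + δ. Squaring is bijective and turns `permF`
into Y·σY + X², so one counts solutions of G(X+a) + C·G(X) = B with C = c² and G = `permFSq`. For
two solutions with difference d, put V = d + σd and A = a + σa, both of trace zero. The difference
relation then involves d only through V and d², and a only through the σ-fixed pairing w = A·σV +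
σA·V.

If σC = C, w is absorbed into Y. Eliminating Y leaves a cubic form in the conjugates of d, which
splits over the field with 8 elements; each linear factor forces V = 0, hence d = 0
(`difference_eq_zero_of_fixed`).

If σC ≠ C, adding the relation to its conjugate leaves an equation in V alone
(`derivative_relation`), and V determines d. With T = Tr(δ), V is a root of a quartic if T ≠ 0
(`derivative_quartic`), and takes at most two values if T = 0 (`derivative_eq_zero_or`). For T = 0
an explicit pair of solutions shows that 2 is attained (`exists_two_solutions`). -/

/-- The square of `permF` in characteristic `2`, written with an endomorphism `σ` in place of
`x ↦ x ^ (2 ^ m)`. -/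
def permFSq {K : Type*} [Field K] (σ : K →+* K) (δ X : K) : K :=
  (σ X + X + δ) * σ (σ X + X + δ) + X ^ 2

/-! ### The difference relation, and coefficients fixed by σ. -/

section CubicEndomorphism

variable {K : Type*} [Field K] [CharP K 2] {σ : K →+* K}

/-- The relation satisfied by the difference `d` of two solutions. -/
theorem permFSq_difference (C a δ X d : K)
    (h : permFSq σ δ (X + a) + C * permFSq σ δ X =
      permFSq σ δ (X + d + a) + C * permFSq σ δ (X + d)) :
    (1 + C) * ((d + σ d) * σ (σ X + X + δ) + σ (d + σ d) * (σ X + X + δ) +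
      (d + σ d) * σ (d + σ d) + d ^ 2) +
      ((a + σ a) * σ (d + σ d) + σ (a + σ a) * (d + σ d)) = 0 := by
  have h2 : (2 : K) = 0 := CharTwo.two_eq_zero
  simp only [permFSq, map_add] at h ⊢
  grind

theorem permFSq_difference_converse (C a δ X d : K)
    (h : (1 + C) * ((d + σ d) * σ (σ X + X + δ) + σ (d + σ d) * (σ X + X + δ) +
      (d + σ d) * σ (d + σ d) + d ^ 2) +
      ((a + σ a) * σ (d + σ d) + σ (a + σ a) * (d + σ d)) = 0) :
    permFSq σ δ (X + d + a) + C * permFSq σ δ (X + d) =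
      permFSq σ δ (X + a) + C * permFSq σ δ X := by
  have h2 : (2 : K) = 0 := CharTwo.two_eq_zero
  simp only [permFSq, map_add] at h ⊢
  grind

/-- The cubic form `∑ x³ + ∑ x²y` splits into linear forms over the field with `8` elements. -/
theorem cubic_eq_prod (u x y z : K) (hu : u ^ 3 + u + 1 = 0) :
    x ^ 3 + y ^ 3 + z ^ 3 + x ^ 2 * y + y ^ 2 * z + z ^ 2 * x =
      (x + u ^ 3 * y + u * z) * (x + (u ^ 2) ^ 3 * y + u ^ 2 * z) *
        (x + (u ^ 4) ^ 3 * y + u ^ 4 * z) := by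
  have h2 : (2 : K) = 0 := CharTwo.two_eq_zero
  have h3 : u ^ 3 = u + 1 := by grind
  have h4 : u ^ 4 = u ^ 2 + u := by grind
  have h6 : (u ^ 2) ^ 3 = u ^ 2 + 1 := by grind
  have h12 : (u ^ 4) ^ 3 = u ^ 2 + u + 1 := by grind
  rw [h12, h6, h3, h4]
  grind

/-- Since u³ = u + 1, the relation says V = u·σV for V = d + σd. As V has trace zero, a polynomial
in u kills V, and it is nonzero in both allowed cases. It would vanish for σu = u⁴, the case m ≡ 2
mod 3. -/
theorem fixed_of_linear_relation (hσ : ∀ x, σ (σ (σ x)) = x) (u d : K)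
    (hu : u ^ 3 + u + 1 = 0) (hσu : σ u = u ∨ σ u = u ^ 2)
    (h : d + u ^ 3 * σ d + u * σ (σ d) = 0) : d + σ d = 0 := by
  have h2 : (2 : K) = 0 := CharTwo.two_eq_zero
  have hu0 : u ≠ 0 := by rintro rfl; simp at hu
  have e0 : d + σ (σ d) = u ^ 2 * (d + σ d) := by
    apply mul_left_cancel₀ hu0; grind
  have e1 := congrArg σ e0
  have e2 := congrArg σ e1
  simp only [map_add, map_mul, map_pow, hσ] at e1 e2
  generalize σ (σ d) = d2 at *
  generalize σ d = d1 at *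
  rcases hσu with hs | hs
  · rw [hs] at e1
    have : (u ^ 4 + u ^ 2 + 1) * (d + d1) = 0 := by grind
    rcases mul_eq_zero.1 this with h | h
    · exfalso
      have : u = 1 := by grind
      subst this; grind
    · exact h
  · rw [hs] at e1
    have h6 : u ^ 6 * (d1 + d2) = u ^ 2 * (d + d1) := by grind
    have : (u ^ 4 + u ^ 6 + 1) * (d + d1) = 0 := by grind
    rcases mul_eq_zero.1 this with h | h
    · exfalso; grind
    · exact h

theorem difference_eq_zero_of_fixed (hσ : ∀ x, σ (σ (σ x)) = x) {u : K}
    (hu : u ^ 3 + u + 1 = 0) (hσu : σ u = u ∨ σ u = u ^ 2) (Z d : K)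
    (h : (d + σ d) * σ Z + σ (d + σ d) * Z + (d + σ d) * σ (d + σ d) + d ^ 2 = 0) : d = 0 := by
  have h2 : (2 : K) = 0 := CharTwo.two_eq_zero
  have hsq : (u ^ 2) ^ 3 + u ^ 2 + 1 = 0 := by grind
  have hfour : (u ^ 4) ^ 3 + u ^ 4 + 1 = 0 := by grind
  have hσsq : σ (u ^ 2) = u ^ 2 ∨ σ (u ^ 2) = (u ^ 2) ^ 2 := by
    rw [map_pow]; rcases hσu with h | h <;> simp [h]
  have hσfour : σ (u ^ 4) = u ^ 4 ∨ σ (u ^ 4) = (u ^ 4) ^ 2 := by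
    rw [map_pow]; rcases hσu with h | h
    · simp [h]
    · right; rw [h]; ring
  -- With V = d + σd and E the left side of `h`, the terms in Z cancel in the trace of σ²V·E; what
  -- remains is this cubic form.
  have hcubic : d ^ 3 + σ d ^ 3 + σ (σ d) ^ 3 + d ^ 2 * σ d + σ d ^ 2 * σ (σ d) +
      σ (σ d) ^ 2 * d = 0 := by
    have h' := congrArg σ h
    have h'' := congrArg σ h'
    simp only [map_add, map_mul, map_pow, map_zero, hσ] at h h' h''
    generalize σ (σ d) = d2 at *
    generalize σ d = d1 at *
    generalize σ (σ Z) = Z2 at *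
    generalize σ Z = Z1 at *
    grind
  have hV : d + σ d = 0 := by
    rw [cubic_eq_prod u _ _ _ hu] at hcubic
    rcases mul_eq_zero.1 hcubic with h | h
    · rcases mul_eq_zero.1 h with h | h
      · exact fixed_of_linear_relation hσ u d hu hσu h
      · exact fixed_of_linear_relation hσ _ d hsq hσsq h
    · exact fixed_of_linear_relation hσ _ d hfour hσfour h
  simpa [hV] using h

theorem eq_of_fixed_coefficient (hσ : ∀ x, σ (σ (σ x)) = x) {u : K}
    (hu : u ^ 3 + u + 1 = 0) (hσu : σ u = u ∨ σ u = u ^ 2) {C : K} (hC : σ C = C)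
    (hC1 : 1 + C ≠ 0) (a δ X Y : K)
    (h : permFSq σ δ (X + a) + C * permFSq σ δ X =
      permFSq σ δ (Y + a) + C * permFSq σ δ Y) : X = Y := by
  have h2 : (2 : K) = 0 := CharTwo.two_eq_zero
  obtain ⟨d, rfl⟩ : ∃ d, Y = X + d := ⟨Y - X, by ring⟩
  have hd := permFSq_difference C a δ X d h
  have hθ : σ (1 + C)⁻¹ = (1 + C)⁻¹ := by simp [hC]
  have hθC : (1 + C)⁻¹ * (1 + C) = 1 := inv_mul_cancel₀ hC1
  have : d = 0 := by
    apply difference_eq_zero_of_fixed hσ hu hσu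
      -- As σ fixes (1 + C)⁻¹, this shift of Y absorbs the pairing term.
      (σ X + X + δ + (1 + C)⁻¹ * (a + σ a)) d
    rw [map_add σ (σ X + X + δ), map_mul σ (1 + C)⁻¹, hθ]
    generalize (1 + C)⁻¹ = θ at *
    linear_combination θ * hd - ((d + σ d) * σ (σ X + X + δ) + σ (d + σ d) * (σ X + X + δ) +
      (d + σ d) * σ (d + σ d) + d ^ 2) * hθC
  simp [this]

/-! ### Equations for V when the coefficient is not fixed. -/

theorem trace_derivative (hσ : ∀ x, σ (σ (σ x)) = x) (d : K) :
    (d + σ d) + σ (d + σ d) + σ (σ (d + σ d)) = 0 := by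
  have h2 : (2 : K) = 0 := CharTwo.two_eq_zero
  simp only [map_add, hσ]
  grind

/-- The alternating pairing of two elements of trace zero is fixed by `σ`. -/
theorem pairing_fixed {A V : K}
    (hA : A + σ A + σ (σ A) = 0) (hV : V + σ V + σ (σ V) = 0) :
    σ (A * σ V + σ A * V) = A * σ V + σ A * V := by
  have h2 : (2 : K) = 0 := CharTwo.two_eq_zero
  simp only [map_add, map_mul]
  grind

omit [CharP K 2] in
theorem trace_fixed (hσ : ∀ x, σ (σ (σ x)) = x) (δ : K) :
    σ (δ + σ δ + σ (σ δ)) = δ + σ δ + σ (σ δ) := by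
  simp only [map_add, hσ]; ring

/-- Adding the difference relation to its conjugate eliminates `d` and `X`. -/
theorem derivative_relation (hσ : ∀ x, σ (σ (σ x)) = x) {C : K} (hC1 : 1 + C ≠ 0)
    (a δ X d : K)
    (h : (1 + C) * ((d + σ d) * σ (σ X + X + δ) + σ (d + σ d) * (σ X + X + δ) +
      (d + σ d) * σ (d + σ d) + d ^ 2) +
      ((a + σ a) * σ (d + σ d) + σ (a + σ a) * (d + σ d)) = 0) :
    σ (σ (d + σ d)) ^ 2 + (δ + σ δ + σ (σ δ)) * σ (d + σ d) =
      ((1 + C)⁻¹ + σ (1 + C)⁻¹) *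
        ((a + σ a) * σ (d + σ d) + σ (a + σ a) * (d + σ d)) := by
  have h2 : (2 : K) = 0 := CharTwo.two_eq_zero
  have hw := pairing_fixed (trace_derivative hσ a) (trace_derivative hσ d)
  have hV := trace_derivative hσ d
  have hY : (σ X + X + δ) + σ (σ X + X + δ) + σ (σ (σ X + X + δ)) =
      δ + σ δ + σ (σ δ) := by
    simp only [map_add, hσ]; grind
  have hθC : (1 + C)⁻¹ * (1 + C) = 1 := inv_mul_cancel₀ hC1
  generalize (a + σ a) * σ (d + σ d) + σ (a + σ a) * (d + σ d) = w at *
  have hE : ((d + σ d) * σ (σ X + X + δ) + σ (d + σ d) * (σ X + X + δ) +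
      (d + σ d) * σ (d + σ d) + d ^ 2) + (1 + C)⁻¹ * w = 0 := by
    linear_combination (1 + C)⁻¹ * h - ((d + σ d) * σ (σ X + X + δ) +
      σ (d + σ d) * (σ X + X + δ) + (d + σ d) * σ (d + σ d) + d ^ 2) * hθC
  have hd : d ^ 2 + σ d ^ 2 = (d + σ d) ^ 2 := (CharTwo.add_sq d (σ d)).symm
  have hE' := congrArg σ hE
  rw [map_add σ _ ((1 + C)⁻¹ * w), map_mul σ (1 + C)⁻¹, hw, map_add σ _ (d ^ 2), map_pow,
    map_add σ (_ + _), map_add σ (_ * _), map_mul, map_mul, map_mul, map_zero] at hE'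
  generalize σ (1 + C)⁻¹ = θ' at *
  generalize (1 + C)⁻¹ = θ at *
  generalize σ X + X + δ = Y at *
  generalize δ + σ δ + σ (σ δ) = T at *
  generalize hVd : d + σ d = V at *
  clear h hθC hw
  generalize σ (σ V) = V2 at *
  generalize σ V = V1 at *
  generalize σ (σ Y) = Y2 at *
  generalize σ Y = Y1 at *
  generalize σ d = d1 at *
  grind

/-- For fixed `X`, the derivative `d + σ d` determines `d`. -/
theorem difference_determined {C : K} (hC1 : 1 + C ≠ 0) (a δ X d e : K)
    (hd : (1 + C) * ((d + σ d) * σ (σ X + X + δ) + σ (d + σ d) * (σ X + X + δ) +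
      (d + σ d) * σ (d + σ d) + d ^ 2) +
      ((a + σ a) * σ (d + σ d) + σ (a + σ a) * (d + σ d)) = 0)
    (he : (1 + C) * ((e + σ e) * σ (σ X + X + δ) + σ (e + σ e) * (σ X + X + δ) +
      (e + σ e) * σ (e + σ e) + e ^ 2) +
      ((a + σ a) * σ (e + σ e) + σ (a + σ a) * (e + σ e)) = 0)
    (h : d + σ d = e + σ e) : d = e := by
  rw [← h] at he
  have : (1 + C) * (d ^ 2 - e ^ 2) = 0 := by linear_combination hd - he
  have := (mul_eq_zero.1 this).resolve_left hC1
  exact CharTwo.sq_injective (sub_eq_zero.1 this)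

/-- The conjugates of `h` share the same w. They express T·σV and T·σ²V through V and w, and (T +
A·σφ)·w through V; eliminating w and cancelling T² leaves V alone. Nothing is divided by T + A·σφ,
which may vanish. -/
theorem derivative_quartic (hσ : ∀ x, σ (σ (σ x)) = x) {T φ A V : K} (hT : σ T = T)
    (hT0 : T ≠ 0) (hA : A + σ A + σ (σ A) = 0) (hV : V + σ V + σ (σ V) = 0)
    (h : σ (σ V) ^ 2 + T * σ V = φ * (A * σ V + σ A * V)) :
    V ^ 4 + ((T + A * σ φ) ^ 2 + σ φ ^ 2 * σ (σ A) ^ 2 + σ (σ φ) * (T + A * σ φ) * A) * V ^ 2 +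
      T * ((T + A * σ φ) ^ 2 + σ (σ φ) * (T + A * σ φ) * σ (σ A)) * V = 0 := by
  have h2 : (2 : K) = 0 := CharTwo.two_eq_zero
  have hw := pairing_fixed hA hV
  generalize hwd : A * σ V + σ A * V = w at *
  have h1 := congrArg σ h
  have h3 := congrArg σ h1
  simp only [map_add, map_mul, map_pow, hσ, hT, hw] at h1 h3
  generalize σ (σ V) = V2 at *
  generalize σ V = V1 at *
  generalize σ (σ A) = A2 at *
  generalize σ A = A1 at *
  generalize σ (σ φ) = φ2 at *
  generalize σ φ = φ1 at *
  clear hσ hT hw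
  have hk : (T + A * φ1) * w = A * V ^ 2 + A2 * T * V := by grind
  have hq : V ^ 4 + T ^ 2 * V ^ 2 + T ^ 3 * V = φ1 ^ 2 * w ^ 2 + T ^ 2 * φ2 * w := by
    have e1 : T * V1 = T * V + V ^ 2 + φ1 * w := by grind
    have e2 : T ^ 2 * V1 ^ 2 = T ^ 2 * V ^ 2 + V ^ 4 + φ1 ^ 2 * w ^ 2 := by
      have := congrArg (· ^ 2) e1
      simp only [CharTwo.add_sq] at this
      linear_combination this
    linear_combination -e2 + T ^ 2 * h3 + (V ^ 4 + T ^ 2 * V ^ 2) * h2 -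
      (V ^ 2 * T ^ 2 + V ^ 4 + w ^ 2 * φ1 ^ 2) * h2
  generalize hκ : T + A * φ1 = κ at *
  have hκ2 : κ ^ 2 = T ^ 2 + A ^ 2 * φ1 ^ 2 := by
    rw [← hκ, CharTwo.add_sq]; ring
  have hk2 : κ ^ 2 * w ^ 2 = A ^ 2 * V ^ 4 + A2 ^ 2 * T ^ 2 * V ^ 2 := by
    have := congrArg (· ^ 2) hk
    simp only [CharTwo.add_sq] at this
    linear_combination this
  apply mul_left_cancel₀ (pow_ne_zero 2 hT0)
  linear_combination κ ^ 2 * hq + φ1 ^ 2 * hk2 + T ^ 2 * φ2 * κ * hk - V ^ 4 * hκ2 +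
    (φ1 ^ 2 * A2 ^ 2 * T ^ 2 * V ^ 2 + T ^ 2 * φ2 * κ * (A * V ^ 2 + A2 * T * V)) * h2

end CubicEndomorphism

/-! ### Bounds on the number of solutions, and a pair attaining 2. -/

section Counting

open Polynomial in
theorem exists_finset_roots_quartic {K : Type*} [Field K] (A B : K) :
    ∃ R : Finset K, R.card ≤ 4 ∧ ∀ V, V ^ 4 + A * V ^ 2 + B * V = 0 → V ∈ R := by
  classical
  let p : K[X] := X ^ 4 + C A * X ^ 2 + C B * X
  have hdeg : p.natDegree = 4 := by simp only [p]; compute_degree!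
  have hp : p ≠ 0 := by rintro h; simp [h] at hdeg
  refine ⟨p.roots.toFinset, ?_, fun V hV => ?_⟩
  · exact (Multiset.toFinset_card_le _).trans ((card_roots' p).trans hdeg.le)
  · rw [Multiset.mem_toFinset, mem_roots hp]
    simpa [p, IsRoot] using hV

variable {K : Type*} [Field K] [CharP K 2] [Finite K] {σ : K →+* K}

theorem exists_sq_eq (x : K) : ∃ y : K, y ^ 2 = x :=
  (Finite.injective_iff_surjective.1 CharTwo.sq_injective) x

theorem solutions_ncard_le (hσ : ∀ x, σ (σ (σ x)) = x) {C : K} (hC1 : 1 + C ≠ 0)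
    (a δ B : K) (R : Finset K)
    (hR : ∀ V, V + σ V + σ (σ V) = 0 → σ (σ V) ^ 2 + (δ + σ δ + σ (σ δ)) * σ V =
      ((1 + C)⁻¹ + σ (1 + C)⁻¹) * ((a + σ a) * σ V + σ (a + σ a) * V) → V ∈ R) :
    {X : K | permFSq σ δ (X + a) + C * permFSq σ δ X = B}.ncard ≤ R.card := by
  rcases Set.eq_empty_or_nonempty {X : K | permFSq σ δ (X + a) + C * permFSq σ δ X = B} with
    h | ⟨X, hX⟩
  · simp [h]
  have key : ∀ Y ∈ {X : K | permFSq σ δ (X + a) + C * permFSq σ δ X = B}, _ := fun Y hY =>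
    permFSq_difference (σ := σ) C a δ X (Y - X) (by
      rw [add_sub_cancel]; exact Eq.trans hX (Eq.symm hY))
  rw [← Set.ncard_coe_finset]
  apply Set.ncard_le_ncard_of_injOn (fun Y => (Y - X) + σ (Y - X))
  · intro Y hY
    exact hR _ (trace_derivative hσ _) (derivative_relation hσ hC1 a δ X _ (key Y hY))
  · intro Y hY Z hZ h
    exact sub_left_injective (difference_determined hC1 a δ X _ _ (key Y hY) (key Z hZ) h)

omit [Finite K] in
theorem coefficient_add_conj_ne_zero {C : K} (hC : σ C ≠ C) :
    (1 + C)⁻¹ + σ (1 + C)⁻¹ ≠ 0 := by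
  intro h
  rw [CharTwo.add_eq_zero, map_inv₀, inv_inj, map_add, map_one] at h
  exact hC (add_left_cancel h).symm

omit [Finite K] in
theorem one_add_ne_zero_of_not_fixed {C : K} (hC : σ C ≠ C) : 1 + C ≠ 0 := by
  intro h
  rw [CharTwo.add_eq_zero] at h
  subst h
  simp at hC

theorem solutions_ncard_le_four (hσ : ∀ x, σ (σ (σ x)) = x) {C : K} (hC : σ C ≠ C)
    (a δ B : K) (hδ : δ + σ δ + σ (σ δ) ≠ 0) :
    {X : K | permFSq σ δ (X + a) + C * permFSq σ δ X = B}.ncard ≤ 4 := by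
  obtain ⟨R, hR4, hR⟩ := exists_finset_roots_quartic
    ((δ + σ δ + σ (σ δ) + (a + σ a) * σ ((1 + C)⁻¹ + σ (1 + C)⁻¹)) ^ 2 +
      σ ((1 + C)⁻¹ + σ (1 + C)⁻¹) ^ 2 * σ (σ (a + σ a)) ^ 2 +
      σ (σ ((1 + C)⁻¹ + σ (1 + C)⁻¹)) *
        (δ + σ δ + σ (σ δ) + (a + σ a) * σ ((1 + C)⁻¹ + σ (1 + C)⁻¹)) * (a + σ a))
    ((δ + σ δ + σ (σ δ)) *
      ((δ + σ δ + σ (σ δ) + (a + σ a) * σ ((1 + C)⁻¹ + σ (1 + C)⁻¹)) ^ 2 +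
      σ (σ ((1 + C)⁻¹ + σ (1 + C)⁻¹)) *
        (δ + σ δ + σ (σ δ) + (a + σ a) * σ ((1 + C)⁻¹ + σ (1 + C)⁻¹)) * σ (σ (a + σ a))))
  refine (solutions_ncard_le hσ (one_add_ne_zero_of_not_fixed hC) a δ B R
    fun V hV h => hR V ?_).trans hR4
  exact derivative_quartic hσ (trace_fixed hσ δ) hδ (trace_derivative hσ a) hV h

omit [Finite K] in
/-- When `δ` has trace zero, the derivative `V` of a difference of solutions is zero or a fixed
square root. -/
theorem derivative_eq_zero_or {φ A V r : K} (hσ : ∀ x, σ (σ (σ x)) = x)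
    (hA : A + σ A + σ (σ A) = 0) (hV : V + σ V + σ (σ V) = 0)
    (h : σ (σ V) ^ 2 = φ * (A * σ V + σ A * V))
    (hr : r ^ 2 = σ φ * (A ^ 2 * σ (σ φ) + σ A ^ 2 * σ φ)) : V = 0 ∨ V = r := by
  have hw := pairing_fixed hA hV
  have hw2 : (A * σ V + σ A * V) ^ 2 = A ^ 2 * σ V ^ 2 + σ A ^ 2 * V ^ 2 := by
    rw [CharTwo.add_sq]; ring
  generalize A * σ V + σ A * V = w at *
  have h1 := congrArg σ h
  have h3 := congrArg σ h1
  simp only [map_mul, map_pow, hσ, hw] at h1 h3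
  -- The conjugates of `h` make V² and (σV)² multiples of w, so the formula for w² becomes a
  -- quadratic equation in w without constant term.
  have hww : w * (w - (A ^ 2 * σ (σ φ) + σ A ^ 2 * σ φ)) = 0 := by
    rw [h1, h3] at hw2
    linear_combination hw2
  rcases mul_eq_zero.1 hww with h0 | h0
  · left; simpa [h0] using h1
  · right
    apply CharTwo.sq_injective
    change V ^ 2 = r ^ 2
    rw [h1, hr, sub_eq_zero.1 h0]

theorem solutions_ncard_le_two (hσ : ∀ x, σ (σ (σ x)) = x) {C : K} (hC : σ C ≠ C)
    (a δ B : K) (hδ : δ + σ δ + σ (σ δ) = 0) :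
    {X : K | permFSq σ δ (X + a) + C * permFSq σ δ X = B}.ncard ≤ 2 := by
  classical
  obtain ⟨r, hr⟩ := exists_sq_eq (σ ((1 + C)⁻¹ + σ (1 + C)⁻¹) *
    ((a + σ a) ^ 2 * σ (σ ((1 + C)⁻¹ + σ (1 + C)⁻¹)) +
      σ (a + σ a) ^ 2 * σ ((1 + C)⁻¹ + σ (1 + C)⁻¹)))
  refine (solutions_ncard_le hσ (one_add_ne_zero_of_not_fixed hC) a δ B {0, r}
    fun V hV h => ?_).trans Finset.card_le_two
  rw [hδ, zero_mul, add_zero] at h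
  simpa using derivative_eq_zero_or hσ (trace_derivative hσ a) hV h hr

/-- If `φ ≠ 0` has trace zero, the equation for `V` has a nonzero solution for some `a`. -/
theorem exists_nonzero_derivative (hσ : ∀ x, σ (σ (σ x)) = x) {φ : K} (hφ : φ ≠ 0)
    (hφT : φ + σ φ + σ (σ φ) = 0) :
    ∃ a V : K, V ≠ 0 ∧ V + σ V + σ (σ V) = 0 ∧
      σ (σ V) ^ 2 = φ * ((a + σ a) * σ V + σ (a + σ a) * V) := by
  have h2 : (2 : K) = 0 := CharTwo.two_eq_zero
  -- The aim is w = 1, which forces V² = σφ. Here w is the trace of a·σr, and a² = 1/σ²φ makes each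
  -- of its three conjugates square to 1.
  obtain ⟨a, ha⟩ := exists_sq_eq (σ (σ φ))⁻¹
  obtain ⟨r, hr⟩ := exists_sq_eq (σ φ)
  have hφ1 : σ φ ≠ 0 := by simpa using hφ
  have hφ2 : σ (σ φ) ≠ 0 := by simpa using hφ
  have ea : a ^ 2 * σ (σ φ) = 1 := by rw [ha, inv_mul_cancel₀ hφ2]
  have ea1 := congrArg σ ea
  have ea2 := congrArg σ ea1
  have hr1 := congrArg σ hr
  have hr2 := congrArg σ hr1
  simp only [map_mul, map_pow, hσ, map_one] at ea1 ea2 hr1 hr2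
  have hw : (a + σ a) * σ r + σ (a + σ a) * r = 1 := by
    apply CharTwo.sq_injective
    simp only [map_add, CharTwo.add_sq, mul_pow, hr, hr1, one_pow]
    linear_combination ea + ea1 + ea2 + σ a ^ 2 * hφT - σ a ^ 2 * φ * h2 + h2
  refine ⟨a, r, ?_, ?_, ?_⟩
  · rintro rfl; simp at hr; exact hφ1 hr.symm
  · apply CharTwo.sq_injective
    simp only [CharTwo.add_sq, hr, hr1, hr2]
    linear_combination hφT
  · rw [hw, hr2, mul_one]

theorem exists_two_solutions (hσ : ∀ x, σ (σ (σ x)) = x) {C : K} (hC : σ C ≠ C)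
    (δ : K) (hδ : δ + σ δ + σ (σ δ) = 0) :
    ∃ a d : K, d ≠ 0 ∧
      permFSq σ δ (d + a) + C * permFSq σ δ d = permFSq σ δ a + C * permFSq σ δ 0 := by
  have h2 : (2 : K) = 0 := CharTwo.two_eq_zero
  have hC1 := one_add_ne_zero_of_not_fixed hC
  obtain ⟨a, V, hV0, hV, h⟩ := exists_nonzero_derivative hσ (coefficient_add_conj_ne_zero hC)
    (trace_derivative hσ (1 + C)⁻¹)
  -- The difference relation at X = 0, solved for d² with V prescribed; it remains to check that d +
  -- σd is indeed V.
  obtain ⟨d, hd⟩ := exists_sq_eq (V * σ δ + σ V * δ + V * σ V +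
    (1 + C)⁻¹ * ((a + σ a) * σ V + σ (a + σ a) * V))
  have hdV : d + σ d = V := by
    apply CharTwo.sq_injective
    have hw := pairing_fixed (trace_derivative hσ a) hV
    -- Trace zero of δ makes V·σδ + σV·δ fixed, so it drops out of d² + σd².
    have hp := pairing_fixed hV hδ
    generalize (a + σ a) * σ V + σ (a + σ a) * V = w at *
    have hd1 := congrArg σ hd
    simp only [map_add, map_mul, map_pow, hw] at hd1 hp
    simp only [CharTwo.add_sq, hd, hd1]
    have hV2 : σ (σ V) = V + σ V := by grind
    rw [hV2, CharTwo.add_sq] at h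
    grind
  refine ⟨a, d, ?_, ?_⟩
  · rintro rfl; simp at hdV; exact hV0 hdV.symm
  · have := permFSq_difference_converse (σ := σ) C a δ 0 d (by
      rw [hdV, hd]
      have hθC : (1 + C) * (1 + C)⁻¹ = 1 := mul_inv_cancel₀ hC1
      simp only [map_zero, zero_add]
      generalize (a + σ a) * σ V + σ (a + σ a) * V = w at *
      linear_combination w * hθC + ((1 + C) * (V * σ δ + σ V * δ + V * σ V) + w) * h2)
    simpa using this

end Counting

/-! ### The subfield of order 2^m and the roots of u³ + u + 1. -/

section Frobenius

variable {K : Type*} [Field K]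

theorem mem_subfield_iff_pow_card [Finite K] (k : Subfield K) {q : ℕ} (hq : 1 < q)
    (hk : Nat.card k = q) (x : K) : x ∈ k ↔ x ^ q = x := by
  classical
  have hsub : (k : Set K) ⊆ {x | x ^ q = x} := by
    intro x hx
    have := Fintype.ofFinite k
    have h := FiniteField.pow_card (⟨x, hx⟩ : k)
    rw [← Nat.card_eq_fintype_card, hk] at h
    exact congrArg Subtype.val h
  have hle : {x : K | x ^ q = x}.ncard ≤ q := by
    have hp := FiniteField.X_pow_card_sub_X_ne_zero K hq
    have : {x : K | x ^ q = x} ⊆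
        ((Polynomial.X ^ q - Polynomial.X : Polynomial K).roots.toFinset : Set K) := by
      intro x hx
      simp only [Finset.mem_coe, Multiset.mem_toFinset, Polynomial.mem_roots hp]
      simpa [sub_eq_zero] using hx
    refine (Set.ncard_le_ncard this (Set.toFinite _)).trans ?_
    rw [Set.ncard_coe_finset]
    refine (Multiset.toFinset_card_le _).trans ((Polynomial.card_roots' _).trans ?_)
    rw [FiniteField.X_pow_card_sub_X_natDegree_eq K hq]
  have := Set.eq_of_subset_of_ncard_le hsub
    (hle.trans (by rw [← hk]; exact (Nat.card_coe_set_eq (k : Set K)).le))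
  exact Set.ext_iff.1 this x

/-- Since 7 divides 8^m − 1 there is an element of order 7, and u⁷ + 1 = (u + 1)(u³ + u + 1)(u³ + u²
+ 1). Inversion, here u⁶, exchanges the roots of the two cubics. -/
theorem exists_root_cubic [CharP K 2] [Fintype K] {m : ℕ} (hK : Fintype.card K = 2 ^ (3 * m)) :
    ∃ u : K, u ^ 3 + u + 1 = 0 := by
  classical
  have h2 : (2 : K) = 0 := CharTwo.two_eq_zero
  have : Fact (Nat.Prime 7) := ⟨by norm_num⟩
  have h7 : 7 ∣ Fintype.card Kˣ := by
    rw [Fintype.card_units, hK, pow_mul]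
    exact Nat.sub_dvd_pow_sub_pow 8 1 m |>.trans (by simp)
  obtain ⟨v, hv⟩ := exists_prime_orderOf_dvd_card 7 h7
  have hv7 : (v : K) ^ 7 = 1 := by
    rw [← Units.val_pow_eq_pow_val, ← hv, pow_orderOf_eq_one, Units.val_one]
  have hv1 : (v : K) + 1 ≠ 0 := by
    intro h
    rw [CharTwo.add_eq_zero] at h
    rw [Units.val_eq_one.1 h, orderOf_one] at hv
    omega
  generalize (v : K) = u at *
  have hprod : (u + 1) * ((u ^ 3 + u + 1) * (u ^ 3 + u ^ 2 + 1)) = 0 := by grind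
  rcases mul_eq_zero.1 ((mul_eq_zero.1 hprod).resolve_left hv1) with h | h
  · exact ⟨u, h⟩
  · refine ⟨u ^ 6, ?_⟩
    grind

theorem pow_two_pow_eq [CharP K 2] {m : ℕ} (hmod : ¬ 2 * m ≡ 1 [MOD 3]) {u : K}
    (hu : u ^ 3 + u + 1 = 0) : u ^ 2 ^ m = u ∨ u ^ 2 ^ m = u ^ 2 := by
  have h2 : (2 : K) = 0 := CharTwo.two_eq_zero
  have h8 : u ^ 8 = u := by grind
  have hpow : ∀ j, u ^ 8 ^ j = u := by
    intro j
    induction j with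
    | zero => simp
    | succ j ih => rw [pow_succ, pow_mul, ih, h8]
  have hm : m = 3 * (m / 3) ∨ m = 3 * (m / 3) + 1 := by
    unfold Nat.ModEq at hmod; omega
  rcases hm with h | h
  · left
    rw [h, pow_mul]; exact hpow _
  · right
    rw [h, pow_succ, pow_mul, pow_mul]
    norm_num [hpow]

end Frobenius

/-! ### Translation between `permF` and `permFSq`. -/

section PermF

variable {K : Type*} [Field K] [Fintype K]

theorem charP_two_of_card {n : ℕ} (hK : Fintype.card K = 2 ^ n) : CharP K 2 := by
  obtain ⟨p, hp⟩ := CharP.exists K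
  obtain ⟨r, hpp, hr⟩ := FiniteField.card K p
  have h : p ∣ 2 ^ n := by rw [← hK, hr]; exact dvd_pow_self p r.ne_zero
  rwa [(Nat.prime_dvd_prime_iff_eq hpp Nat.prime_two).1 (hpp.dvd_of_dvd_pow h)] at hp

theorem permF_sq [CharP K 2] {m : ℕ} (hm : 0 < m) (hK : Fintype.card K = 2 ^ (3 * m))
    (δ X : K) : permF m δ X ^ 2 = permFSq (iterateFrobenius K 2 m) δ X := by
  have h : (2 ^ (3 * m - 1) + 2 ^ (m - 1)) * 2 = 2 ^ (3 * m) + 2 ^ m := by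
    rw [add_mul, ← pow_succ, ← pow_succ]
    congr 2 <;> omega
  rw [permF, CharTwo.add_sq, ← pow_mul, h, pow_add, ← hK, FiniteField.pow_card]
  simp only [permFSq, iterateFrobenius_def]

theorem cDerivative_permF_eq_iff [CharP K 2] {m : ℕ} (hm : 0 < m)
    (hK : Fintype.card K = 2 ^ (3 * m)) (δ c a b X : K) :
    cDerivative (permF m δ) c a X = b ↔
      permFSq (iterateFrobenius K 2 m) δ (X + a) +
        c ^ 2 * permFSq (iterateFrobenius K 2 m) δ X = b ^ 2 := by
  rw [← permF_sq hm hK, ← permF_sq hm hK, cDerivative, CharTwo.sub_eq_add, ← mul_pow,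
    ← CharTwo.add_sq]
  exact CharTwo.sq_injective.eq_iff.symm

theorem cDDT_permF [CharP K 2] {m : ℕ} (hm : 0 < m)
    (hK : Fintype.card K = 2 ^ (3 * m)) (δ c a b : K) :
    cDDT (permF m δ) c a b = {X : K | permFSq (iterateFrobenius K 2 m) δ (X + a) +
        c ^ 2 * permFSq (iterateFrobenius K 2 m) δ X = b ^ 2}.ncard := by
  simp only [cDDT, cDerivative_permF_eq_iff hm hK]

theorem cDDT_le_cDiffUniformity {F : K → K} {c : K} (hc : c ≠ 1) (a b : K) :
    cDDT F c a b ≤ cDiffUniformity F c := by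
  classical
  exact Finset.le_sup (f := fun ab : K × K => cDDT F c ab.1 ab.2) (b := (a, b))
    (Finset.mem_filter.2 ⟨Finset.mem_univ _, fun h => absurd h hc⟩)

theorem cDiffUniformity_le {F : K → K} {c : K} {N : ℕ} (h : ∀ a b, cDDT F c a b ≤ N) :
    cDiffUniformity F c ≤ N :=
  Finset.sup_le fun ab _ => h ab.1 ab.2

theorem iterateFrobenius_three [CharP K 2] {m : ℕ} (hK : Fintype.card K = 2 ^ (3 * m)) (x : K) :
    iterateFrobenius K 2 m (iterateFrobenius K 2 m (iterateFrobenius K 2 m x)) = x := by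
  simp only [iterateFrobenius_def, ← pow_mul, ← pow_add]
  rw [show m + m + m = 3 * m by ring, ← hK, FiniteField.pow_card]

omit [Fintype K] in
theorem relTrace_eq [CharP K 2] {m : ℕ} (hm : 0 < m) (x : K) :
    relTrace 2 m (3 * m) x = x + iterateFrobenius K 2 m x +
      iterateFrobenius K 2 m (iterateFrobenius K 2 m x) := by
  simp only [relTrace, Nat.mul_div_cancel _ hm, Finset.sum_range_succ, Finset.sum_range_zero,
    iterateFrobenius_def, ← pow_mul, ← pow_add]
  simp [mul_two]

end PermF

theorem theorem3p5 {K : Type*} [Field K] [Fintype K] (m : ℕ) (hm : 0 < m)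
    (hmod : ¬ 2 * m ≡ 1 [MOD 3]) (hK : Fintype.card K = 2 ^ (3 * m))
    (k : Subfield K) (hk : Nat.card k = 2 ^ m) :
    (∀ c : K, c ∈ k → c ≠ 1 → ∀ δ : K, IsPcN (permF m δ) c) ∧
    (∀ c : K, c ∉ k → ∀ δ : K, relTrace 2 m (3 * m) δ = 0 → IsAPcN (permF m δ) c) ∧
    (∀ c : K, c ∉ k → ∀ δ : K, relTrace 2 m (3 * m) δ ≠ 0 →
      cDiffUniformity (permF m δ) c ≤ 4) := by
  have : CharP K 2 := charP_two_of_card hK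
  have hσ := iterateFrobenius_three hK
  have hmem : ∀ c : K, c ∈ k ↔ iterateFrobenius K 2 m (c ^ 2) = c ^ 2 := fun c => by
    rw [mem_subfield_iff_pow_card k (Nat.one_lt_two_pow hm.ne') hk, map_pow,
      CharTwo.sq_injective.eq_iff (a := iterateFrobenius K 2 m c), iterateFrobenius_def]
  refine ⟨fun c hc hc1 δ => ?_, fun c hc δ hδ => ?_, fun c hc δ hδ => ?_⟩
  · obtain ⟨u, hu⟩ := exists_root_cubic hK
    have hC1 : 1 + c ^ 2 ≠ 0 := by
      rw [Ne, CharTwo.add_eq_zero, eq_comm]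
      simpa using CharTwo.sq_injective.ne hc1
    apply le_antisymm
    · refine cDiffUniformity_le fun a b => ?_
      rw [cDDT_permF hm hK, Set.ncard_le_one]
      intro X hX Y hY
      exact eq_of_fixed_coefficient hσ hu (pow_two_pow_eq hmod hu) ((hmem c).1 hc) hC1 a δ X Y
        (Eq.trans hX (Eq.symm hY))
    · refine le_trans ?_ (cDDT_le_cDiffUniformity hc1 0 (cDerivative (permF m δ) c 0 0))
      exact (Set.ncard_pos (Set.toFinite _)).2 ⟨0, rfl⟩
  · have hC := mt (hmem c).2 hc
    rw [relTrace_eq hm] at hδ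
    have hc1 : c ≠ 1 := by rintro rfl; exact hc k.one_mem
    apply le_antisymm
    · refine cDiffUniformity_le fun a b => ?_
      rw [cDDT_permF hm hK]
      exact solutions_ncard_le_two hσ hC a δ _ hδ
    · obtain ⟨a, d, hd, h⟩ := exists_two_solutions hσ hC δ hδ
      refine le_trans ?_ (cDDT_le_cDiffUniformity hc1 a (cDerivative (permF m δ) c a 0))
      -- With b the value of the derivative at 0, both d and 0 are solutions.
      rw [← Set.ncard_pair hd]
      refine Set.ncard_le_ncard ?_ (Set.toFinite _)
      rintro X (rfl | rfl)
      · refine (cDerivative_permF_eq_iff hm hK _ _ _ _ _).2 (h.trans ?_)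
        rw [← (cDerivative_permF_eq_iff hm hK δ c a _ 0).1 rfl, zero_add]
      · rfl
  · have hC := mt (hmem c).2 hc
    rw [relTrace_eq hm] at hδ
    refine cDiffUniformity_le fun a b => ?_
    rw [cDDT_permF hm hK]
    exact solutions_ncard_le_four hσ hC a δ _ hδ
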